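/- Let $\omega_1$ be the first uncountable ordinal and let $2^{\omega_1}$ be the Cantor cube, that is, the product of $\omega_1$ copies of the two-point discrete space with the product topology. A topological space $X$ is called H-separable if for every sequence $(Y_n)_{n\in\mathbb N}$ of dense subspaces of $X$ there are finite sets $F_n\subseteq Y_n$ $(n\in\mathbb N)$ such that every nonempty open set of $X$ intersects $F_n$ for all but finitely many $n$. Let $\mathcal I$ be an ideal on $\mathbb N$ (a family of subsets of $\mathbb N$ closed under finite unions and under subsets) which is proper ($\mathbb N\notin\mathcal I$) and admissible ($\{n\}\in\mathcal I$ for every $n\in\mathbb N$). A space $X$ is called $\mathcal I$-H-separable if for every sequence $(Y_n)_{n\in\mathbb N}$ of dense subspaces of $X$ there are finite sets $F_n\subseteq Y_n$ $(n\in\mathbb N)$ such that for every nonempty open set $U$ of $X$ we have $\{n\in\mathbb N : U\cap F_n=\emptyset\}\in\mathcal I$. Then: 1. $2^{\omega_1}$ contains a dense H-separable subspace. 2. For every proper admissible ideal $\mathcal I$ on $\mathbb N$, $2^{\omega_1}$ contains a countable dense $\mathcal I$-H-separable subspace. -/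

import Mathlib

open scoped Ordinal

/-- A topological space `X` is *H-separable* if for every sequence `(Y n)` of dense subsets of `X`
one can pick finite sets `F n ⊆ Y n` such that every nonempty open set of `X` meets `F n`
for all but finitely many `n`. -/
def HSeparable (X : Type*) [TopologicalSpace X] : Prop :=
  ∀ Y : ℕ → Set X, (∀ n, Dense (Y n)) →
    ∃ F : ℕ → Finset X, (∀ n, (F n : Set X) ⊆ Y n) ∧
      ∀ U : Set X, IsOpen U → U.Nonempty → {n : ℕ | U ∩ (F n : Set X) = ∅}.Finite

/-- An ideal of subsets of `ℕ` (closed under finite unions and under subsets, that is, an order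
ideal of `Set ℕ`) is *proper admissible* if it is not the whole power set and contains all
singletons. -/
structure IsProperAdmissible (I : Order.Ideal (Set ℕ)) : Prop where
  isProper : I.IsProper
  singleton_mem : ∀ n : ℕ, ({n} : Set ℕ) ∈ I

/-- A topological space `X` is *`I`-H-separable* if for every sequence `(Y n)` of dense subsets of
`X` one can pick finite sets `F n ⊆ Y n` such that for every nonempty open set `U` of `X` the set
of those `n` for which `U` misses `F n` belongs to the ideal `I`. -/
def IdealHSeparable (I : Order.Ideal (Set ℕ)) (X : Type*) [TopologicalSpace X] : Prop :=
  ∀ Y : ℕ → Set X, (∀ n, Dense (Y n)) →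
    ∃ F : ℕ → Finset X, (∀ n, (F n : Set X) ⊆ Y n) ∧
      ∀ U : Set X, IsOpen U → U.Nonempty → {n : ℕ | U ∩ (F n : Set X) = ∅} ∈ I

/-- The Cantor cube `2^{ω₁}`: the product of `ω₁` copies of the two-point discrete space, with the
product topology. -/
abbrev CantorCubeOmegaOne : Type :=
  (ω₁ : Ordinal.{0}).ToType → Bool

/-! Index the cube by an `ℵ₁`-sized subspace of the Cantor space whose finite powers are all
Hurewicz. The traces of clopen sets form a countable dense subspace, since finitely many distinct
points are separated by clopen sets. Given dense `Y n`, the least index of a member of `Y n`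
agreeing with a fixed trace on a `k`-tuple is locally bounded in the tuple; the Hurewicz property
bounds it by one sequence for all tuples and almost all `n`, so finite pieces of `Y n` suffice
(`hSeparable_range_clopenTrace`). The same subspace serves every ideal, as finite sets belong to
`I`.

The subspace exists by a dichotomy (`exists_injective_hurewiczPowers`): if all `ℵ₁`-families of
sequences are bounded, any injection works; otherwise an unbounded scale together with the finite
sets works. -/

open Set Filter Cardinal

/-! ### Eventual domination and scales. -/

section Domination

/-- A countable family of sequences of natural numbers is eventually dominated by a strictly
increasing sequence. -/
theorem exists_strictMono_eventually_lt {J : Type*} [Countable J] (g : J → ℕ → ℕ) (f : ℕ → ℕ) :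
    ∃ h : ℕ → ℕ, StrictMono h ∧ (∀ n, f n ≤ h n) ∧ ∀ j, ∀ᶠ n in atTop, g j n < h n := by
  obtain ⟨c, hc⟩ := exists_injective_nat J
  classical
  let G : ℕ → ℕ → ℕ := fun i n ↦ if hi : ∃ j, c j = i then g hi.choose n else 0
  have hG : ∀ j, G (c j) = g j := by
    intro j
    have hi : ∃ j', c j' = c j := ⟨j, rfl⟩
    have : hi.choose = j := hc hi.choose_spec
    funext n
    simp only [G, dif_pos hi, this]
  let t : ℕ → ℕ := fun n ↦ f n + ∑ i ∈ Finset.range (n + 1), G i n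
  refine ⟨fun n ↦ ∑ m ∈ Finset.range (n + 1), (t m + 1), ?_, ?_, ?_⟩
  · refine strictMono_nat_of_lt_succ fun n ↦ ?_
    rw [Finset.sum_range_succ _ (n + 1)]
    omega
  · intro n
    simp only [Finset.sum_range_succ _ n, t]
    omega
  · intro j
    filter_upwards [eventually_ge_atTop (c j)] with n hn
    have h1 : G (c j) n ≤ ∑ i ∈ Finset.range (n + 1), G i n :=
      Finset.single_le_sum (f := fun i ↦ G i n) (fun _ _ ↦ Nat.zero_le _)
        (Finset.mem_range.2 (by omega))
    rw [hG] at h1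
    rw [Finset.sum_range_succ]
    simp only [t]
    omega

/-- In a well-order with countable initial segments, every family of sequences is pointwise
dominated by a family of strictly increasing sequences which increases modulo finite sets. -/
theorem exists_scale {ι : Type*} [LinearOrder ι] [WellFoundedLT ι]
    (hι : ∀ a : ι, Countable (Iio a)) (f : ι → ℕ → ℕ) :
    ∃ b : ι → ℕ → ℕ, (∀ a, StrictMono (b a)) ∧ (∀ a n, f a n ≤ b a n) ∧
      ∀ a a', a < a' → ∀ᶠ n in atTop, b a n < b a' n := by
  have key : ∀ (a : ι) (g : Iio a → ℕ → ℕ), ∃ h : ℕ → ℕ, StrictMono h ∧ (∀ n, f a n ≤ h n) ∧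
      ∀ j, ∀ᶠ n in atTop, g j n < h n := fun a g ↦
    have := hι a
    exists_strictMono_eventually_lt g (f a)
  choose H hH using key
  let b : ι → ℕ → ℕ := (wellFounded_lt (α := ι)).fix fun a ih ↦ H a fun j ↦ ih j.1 j.2
  have hb : ∀ a, b a = H a fun j ↦ b j.1 := fun a ↦ WellFounded.fix_eq _ _ _
  refine ⟨b, fun a ↦ ?_, fun a n ↦ ?_, fun a a' h ↦ ?_⟩
  · rw [hb]; exact (hH _ _).1
  · rw [hb]; exact (hH _ _).2.1 n
  · rw [hb a']; exact (hH a' fun j ↦ b j.1).2.2 ⟨a, h⟩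

end Domination

/-! ### A subspace of size `ℵ₁` with Hurewicz finite powers. -/

section HurewiczPowers

/-- A function of finitely many indices into the Baire space is *locally bounded along* `e` if,
coordinatewise, it is locally bounded by its value for the topology which `e` induces from the
Cantor space. -/
def LocallyBoundedAlong {ι : Type*} (e : ι → ℕ → Bool) {k : ℕ} (Ψ : (Fin k → ι) → ℕ → ℕ) : Prop :=
  ∀ x n, ∃ m, ∀ y, (∀ i, ∀ j < m, e (y i) j = e (x i) j) → Ψ y n ≤ Ψ x n

/-- The finite powers of the subspace of the Cantor space enumerated by `e` have the Hurewicz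
property: upper semicontinuous images in the Baire space are eventually bounded. -/
def HurewiczPowers {ι : Type*} (e : ι → ℕ → Bool) : Prop :=
  ∀ (k : ℕ) (Ψ : (Fin k → ι) → ℕ → ℕ), LocallyBoundedAlong e Ψ → (∀ x, Monotone (Ψ x)) →
    ∃ h : ℕ → ℕ, ∀ x, ∀ᶠ n in atTop, Ψ x n ≤ h n

theorem HurewiczPowers.comp_equiv {ι κ : Type*} {e : ι → ℕ → Bool} (he : HurewiczPowers e)
    (σ : κ ≃ ι) : HurewiczPowers (e ∘ σ) := by
  intro k Ψ hΨ hmono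
  obtain ⟨h, hh⟩ := he k (fun x ↦ Ψ (σ.symm ∘ x)) (fun x n ↦ by
    obtain ⟨m, hm⟩ := hΨ (σ.symm ∘ x) n
    exact ⟨m, fun y hy ↦ hm _ (by simpa using hy)⟩) (fun x ↦ hmono _)
  refine ⟨h, fun x ↦ ?_⟩
  have := hh (σ ∘ x)
  rwa [← Function.comp_assoc, Equiv.symm_comp_self, Function.id_comp] at this

/-- If every family of sequences indexed by `ι` is eventually bounded, then every `ι`-indexed
subspace of the Cantor space has Hurewicz finite powers. -/
theorem hurewiczPowers_of_bounded {ι : Type*} [Infinite ι]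
    (hι : ∀ f : ι → ℕ → ℕ, ∃ h : ℕ → ℕ, ∀ i, ∀ᶠ n in atTop, f i n ≤ h n)
    (e : ι → ℕ → Bool) : HurewiczPowers e := by
  intro k Ψ _ _
  have hcard : #(Fin k → ι) ≤ #ι := by
    have := power_nat_le (n := k) (aleph0_le_mk ι)
    simpa using this
  obtain ⟨c⟩ := hcard
  have : Nonempty (Fin k → ι) := inferInstance
  obtain ⟨h, hh⟩ := hι (fun i ↦ Ψ (Function.invFun c i))
  refine ⟨h, fun x ↦ ?_⟩
  have := hh (c x)
  rwa [Function.leftInverse_invFun c.injective x] at this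

/-- The characteristic functions of the ranges of the sequences `b a` and of the finite sets. -/
noncomputable def scaleUnionFinite {ι : Type*} (b : ι → ℕ → ℕ) : ι ⊕ Finset ℕ → ℕ → Bool :=
  open Classical in
  Sum.elim (fun a j ↦ decide (j ∈ range (b a))) (fun s j ↦ decide (j ∈ s))

theorem scaleUnionFinite_inl {ι : Type*} (b : ι → ℕ → ℕ) (a : ι) (j : ℕ) :
    scaleUnionFinite b (.inl a) j = true ↔ ∃ l, b a l = j := by
  simp [scaleUnionFinite]

theorem scaleUnionFinite_inr {ι : Type*} (b : ι → ℕ → ℕ) (s : Finset ℕ) (j : ℕ) :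
    scaleUnionFinite b (.inr s) j = true ↔ j ∈ s := by
  simp [scaleUnionFinite]

theorem scaleUnionFinite_injective {ι : Type*} [LinearOrder ι] {b : ι → ℕ → ℕ}
    (hb : ∀ a, StrictMono (b a)) (hlt : ∀ a a', a < a' → ∀ᶠ n in atTop, b a n < b a' n) :
    Function.Injective (scaleUnionFinite b) := by
  have hinj : Function.Injective b := by
    intro a a' h
    by_contra hne
    rcases lt_or_gt_of_ne hne with h' | h' <;>
    · obtain ⟨n, hn⟩ := (hlt _ _ h').exists
      rw [h] at hn
      exact lt_irrefl _ hn
  have hfin : ∀ a s, scaleUnionFinite b (.inl a) ≠ scaleUnionFinite b (.inr s) := by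
    intro a s h
    have : range (b a) = s := by
      ext j
      have := congrFun h j
      rw [Bool.eq_iff_iff, scaleUnionFinite_inl, scaleUnionFinite_inr] at this
      simpa using this
    exact infinite_range_of_injective (hb a).injective (this ▸ s.finite_toSet)
  rintro (a | s) (a' | s') h
  · congr 1
    refine hinj (((hb a).range_inj (hb a')).1 ?_)
    ext j
    have := congrFun h j
    rwa [Bool.eq_iff_iff, scaleUnionFinite_inl, scaleUnionFinite_inl] at this
  · exact (hfin _ _ h).elim
  · exact (hfin _ _ h.symm).elim
  · congr 1
    ext j
    have := congrFun h j
    rwa [Bool.eq_iff_iff, scaleUnionFinite_inr, scaleUnionFinite_inr] at this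

/-- Compactness of the initial part of the power set of `ℕ`: tuples of sets with a common gap
`[g n, g (n + 1))` look like tuples of finite sets, and `Ψ` is bounded on them. -/
theorem exists_monotone_gap_bound {ι : Type*} (b : ι → ℕ → ℕ) {k : ℕ}
    {Ψ : (Fin k → ι ⊕ Finset ℕ) → ℕ → ℕ} (hΨ : LocallyBoundedAlong (scaleUnionFinite b) Ψ) :
    ∃ g : ℕ → ℕ, Monotone g ∧ ∀ x n,
      (∀ i, ∀ j, g n ≤ j → j < g (n + 1) → scaleUnionFinite b (x i) j = false) →
      Ψ x n ≤ g (n + 1) := by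
  have step : ∀ n a : ℕ, ∃ a', a ≤ a' ∧ ∀ x,
      (∀ i, ∀ j, a ≤ j → j < a' → scaleUnionFinite b (x i) j = false) → Ψ x n ≤ a' := by
    intro n a
    choose m hm using fun s : Fin k → (Finset.range a).powerset ↦
      hΨ (fun i ↦ .inr (s i).1) n
    let M : (Fin k → (Finset.range a).powerset) → ℕ :=
      fun s ↦ m s + Ψ (fun i ↦ .inr (s i).1) n
    have hM : ∀ s, M s ≤ a + Finset.univ.sup M := fun s ↦
      (Finset.le_sup (f := M) (Finset.mem_univ s)).trans (Nat.le_add_left _ _)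
    -- The endpoint exceeds both the radius and the value at each of the finitely many tuples of
    -- subsets of `[0, a)`; a tuple with no points in the gap agrees with its trace on `[0, a)` up
    -- to that radius.
    refine ⟨a + Finset.univ.sup M, Nat.le_add_right _ _, fun x hx ↦ ?_⟩
    let s : Fin k → (Finset.range a).powerset := fun i ↦
      ⟨(Finset.range a).filter fun j ↦ scaleUnionFinite b (x i) j = true,
        Finset.mem_powerset.2 (Finset.filter_subset _ _)⟩
    have hs := hM s
    refine (hm s x fun i j hj ↦ ?_).trans ((Nat.le_add_left _ _).trans hs)
    rw [Bool.eq_iff_iff, scaleUnionFinite_inr, Finset.mem_filter, Finset.mem_range]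
    refine ⟨fun h ↦ ⟨?_, h⟩, fun h ↦ h.2⟩
    by_contra hja
    have := hx i j (not_lt.1 hja) (hj.trans_le ((Nat.le_add_right _ _).trans hs))
    simp [this] at h
  choose A hA hA' using step
  let g : ℕ → ℕ := fun n ↦ Nat.rec 0 (fun n a ↦ A n a) n
  exact ⟨g, monotone_nat_of_le_succ fun n ↦ hA n (g n), fun x n h ↦ hA' n (g n) x h⟩

/-- Pigeonhole: `k` strictly increasing sequences which are large at `N` miss a common interval
among more than `k * N` consecutive ones. -/
theorem exists_common_gap {k N a c : ℕ} {g : ℕ → ℕ} (hg : Monotone g) {B : Fin k → ℕ → ℕ}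
    (hB : ∀ i, StrictMono (B i)) (hN : ∀ i, g c ≤ B i N) (hc : a + k * N < c) :
    ∃ n, a ≤ n ∧ n < c ∧ ∀ i l, g n ≤ B i l → B i l < g (n + 1) → False := by
  by_contra! H
  -- Points below `g c` have index `l < N`, so only `k * N` of them are available to hit the
  -- disjoint intervals.
  have H' : ∀ n : Finset.Ico a c, ∃ p : Fin k × Fin N,
      g n ≤ B p.1 p.2 ∧ B p.1 p.2 < g (n + 1) := by
    rintro ⟨n, hn⟩
    rw [Finset.mem_Ico] at hn
    obtain ⟨i, l, h1, h2, -⟩ := H n hn.1 hn.2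
    refine ⟨⟨i, l, (hB i).lt_iff_lt.1 (h2.trans_le ((hg hn.2).trans (hN i)))⟩, h1, h2⟩
  choose p hp1 hp2 using H'
  have hinj : Function.Injective p := by
    intro n n' h
    by_contra hne
    rcases lt_or_gt_of_ne (Subtype.coe_ne_coe.2 hne) with h' | h'
    · have h1 := hp2 n
      have h2 := hp1 n'
      rw [← h] at h2
      exact absurd (hg (Nat.succ_le_of_lt h')) (by simp only [Nat.succ_eq_add_one]; omega)
    · have h1 := hp2 n'
      have h2 := hp1 n
      rw [h] at h2
      exact absurd (hg (Nat.succ_le_of_lt h')) (by simp only [Nat.succ_eq_add_one]; omega)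
  have := Fintype.card_le_of_injective p hinj
  simp at this
  omega

/-- A scale together with the finite sets has Hurewicz finite powers. -/
theorem hurewiczPowers_scaleUnionFinite {ι : Type*} [LinearOrder ι]
    (hι : ∀ a : ι, Countable (Iio a)) {b : ι → ℕ → ℕ}
    (hb : ∀ a, StrictMono (b a)) (hlt : ∀ a a', a < a' → ∀ᶠ n in atTop, b a n < b a' n)
    (hunb : ∀ h : ℕ → ℕ, ∃ a, ∃ᶠ n in atTop, h n < b a n) :
    HurewiczPowers (scaleUnionFinite b) := by
  intro k
  induction k with
  | zero =>
    intro Ψ _ _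
    exact ⟨Ψ default, fun x ↦ by rw [Subsingleton.elim x default]; simp⟩
  | succ k ih =>
    intro Ψ hΨ hmono
    obtain ⟨g, hg, hgΨ⟩ := exists_monotone_gap_bound b hΨ
    -- For `a ≤ N` this leaves more than `(k + 1) * N` intervals from `a` on, as the pigeonhole
    -- requires. One `α` serves all tuples of scale members from `α` on.
    obtain ⟨α, hα⟩ := hunb fun N ↦ g ((k + 1) * N + N + 1)
    choose N hN hN' using frequently_atTop.1 hα
    -- The remaining tuples have a coordinate in this countable set; fixing it reduces to the `k`-th
    -- power.
    let C : Set (ι ⊕ Finset ℕ) := Sum.inl '' Iio α ∪ range Sum.inr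
    have hC : C.Countable := by
      have := hι α
      exact ((to_countable (Iio α)).image _).union (countable_range _)
    have := hC.to_subtype
    choose h hh using fun p : Fin (k + 1) × C ↦
      ih (fun y ↦ Ψ (p.1.insertNth (α := fun _ ↦ ι ⊕ Finset ℕ) p.2.1 y)) (fun y n ↦ by
        obtain ⟨m, hm⟩ := hΨ (p.1.insertNth (α := fun _ ↦ ι ⊕ Finset ℕ) p.2.1 y) n
        refine ⟨m, fun z hz ↦ hm _ fun i j hj ↦ ?_⟩
        induction i using p.1.succAboveCases with
        | x => simp
        | p i => simpa using hz i j hj) (fun y ↦ hmono _)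
    obtain ⟨H, -, hgH, hhH⟩ := exists_strictMono_eventually_lt h
      (fun a ↦ g ((k + 1) * N a + N a + 1))
    refine ⟨H, fun x ↦ ?_⟩
    by_cases hx : ∃ i, x i ∈ C
    · obtain ⟨i, hi⟩ := hx
      filter_upwards [hh ⟨i, x i, hi⟩ (i.removeNth x), hhH ⟨i, x i, hi⟩] with n h1 h2
      simp only [Fin.insertNth_self_removeNth] at h1
      omega
    · push Not at hx
      have hx' : ∀ i, ∃ β, α ≤ β ∧ x i = .inl β := by
        intro i
        have := hx i
        rcases hxi : x i with β | s
        · refine ⟨β, not_lt.1 fun h ↦ this (Or.inl ⟨β, h, hxi.symm⟩), rfl⟩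
        · exact (this (Or.inr ⟨s, hxi.symm⟩)).elim
      choose β hβ hxβ using hx'
      have hev : ∀ᶠ n in atTop, ∀ i, b α n ≤ b (β i) n := by
        refine eventually_all.2 fun i ↦ ?_
        rcases (hβ i).eq_or_lt with h | h
        · rw [← h]; simp
        · exact (hlt _ _ h).mono fun _ ↦ le_of_lt
      obtain ⟨N₀, hN₀⟩ := eventually_atTop.1 hev
      filter_upwards [eventually_ge_atTop N₀] with a ha
      have haN : a ≤ N a := hN a
      obtain ⟨n, han, hnc, hn⟩ := exists_common_gap (N := N a) (a := a)
        (c := (k + 1) * N a + N a + 1) hg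
        (B := fun i ↦ b (β i)) (fun i ↦ hb _)
        (fun i ↦ (hN' a).le.trans (hN₀ _ (ha.trans haN) i)) (by omega)
      refine (hmono x han).trans ((hgΨ x n fun i j h1 h2 ↦ ?_).trans ((hg hnc).trans (hgH a)))
      rw [hxβ, Bool.eq_false_iff, Ne, scaleUnionFinite_inl]
      rintro ⟨l, rfl⟩
      exact hn i l h1 h2

/-- The Cantor space has a subspace of size `ℵ₁` all of whose finite powers are Hurewicz. -/
theorem exists_injective_hurewiczPowers {ι : Type} [LinearOrder ι] [WellFoundedLT ι]
    (hι : ∀ a : ι, Countable (Iio a)) (hcard : #ι = ℵ₁) :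
    ∃ e : ι → ℕ → Bool, Function.Injective e ∧ HurewiczPowers e := by
  have hinf : Infinite ι := by
    rw [infinite_iff, hcard]; exact aleph0_lt_aleph_one.le
  by_cases hbd : ∀ f : ι → ℕ → ℕ, ∃ h : ℕ → ℕ, ∀ i, ∀ᶠ n in atTop, f i n ≤ h n
  · have : #ι ≤ #(ℕ → Bool) := by
      rw [hcard]; simpa using aleph_one_le_continuum
    obtain ⟨e⟩ := this
    exact ⟨e, e.injective, hurewiczPowers_of_bounded hbd e⟩
  · push Not at hbd
    obtain ⟨f, hf⟩ := hbd
    obtain ⟨b, hb, hfb, hlt⟩ := exists_scale hι f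
    have hunb : ∀ h : ℕ → ℕ, ∃ a, ∃ᶠ n in atTop, h n < b a n := by
      intro h
      obtain ⟨a, ha⟩ := hf h
      exact ⟨a, ha.mono fun n hn ↦ hn.trans_le (hfb a n)⟩
    have hequiv : #ι = #(ι ⊕ Finset ℕ) := by
      simpa [hcard] using (add_eq_left aleph0_lt_aleph_one.le aleph0_lt_aleph_one.le).symm
    obtain ⟨σ⟩ := Cardinal.eq.1 hequiv
    exact ⟨scaleUnionFinite b ∘ σ, (scaleUnionFinite_injective hb hlt).comp σ.injective,
      (hurewiczPowers_scaleUnionFinite hι hb hlt hunb).comp_equiv σ⟩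

end HurewiczPowers

/-! ### Clopen traces: density and H-separability. -/

section ClopenTraces

/-- The trace along `e` of the clopen subset of the Cantor space determined by the predicate `p.2`
on the first `p.1` coordinates. -/
def clopenTrace {ι : Type*} (e : ι → ℕ → Bool) (p : Σ m : ℕ, (Fin m → Bool) → Bool) (i : ι) :
    Bool :=
  p.2 fun j ↦ e i j

theorem clopenTrace_congr {ι : Type*} (e : ι → ℕ → Bool) {p : Σ m : ℕ, (Fin m → Bool) → Bool}
    {i i' : ι} {m : ℕ} (hm : p.1 ≤ m) (h : ∀ j < m, e i j = e i' j) :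
    clopenTrace e p i = clopenTrace e p i' := by
  unfold clopenTrace
  exact congrArg p.2 (funext fun j ↦ h j (j.2.trans_le hm))

theorem dense_range_clopenTrace {ι : Type*} {e : ι → ℕ → Bool} (he : Function.Injective e) :
    Dense (range (clopenTrace e)) := by
  classical
  rw [dense_iff_inter_open]
  rintro U hU ⟨t, ht⟩
  obtain ⟨S, u, hu, hSU⟩ := isOpen_pi_iff.1 hU t ht
  have hsep : ∀ i i' : ι, ∃ m, i ≠ i' → ∃ j < m, e i j ≠ e i' j := by
    intro i i'
    by_cases h : i = i'
    · exact ⟨0, fun h' ↦ (h' h).elim⟩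
    · obtain ⟨j, hj⟩ := Function.ne_iff.1 (he.ne h)
      exact ⟨j + 1, fun _ ↦ ⟨j, by omega, hj⟩⟩
  choose m hm using hsep
  let M := (S ×ˢ S).sup fun q ↦ m q.1 q.2
  let p : Σ m : ℕ, (Fin m → Bool) → Bool :=
    ⟨M, fun v ↦ decide (∃ i ∈ S, t i = true ∧ ∀ j : Fin M, e i j = v j)⟩
  refine ⟨clopenTrace e p, hSU fun i hi ↦ ?_, mem_range_self p⟩
  have : clopenTrace e p i = t i := by
    rw [Bool.eq_iff_iff]
    simp only [clopenTrace, p, decide_eq_true_eq]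
    refine ⟨?_, fun h ↦ ⟨i, hi, h, fun _ ↦ rfl⟩⟩
    rintro ⟨i', hi', h1, h2⟩
    by_contra hne
    have hii : i' ≠ i := by rintro rfl; exact hne h1
    obtain ⟨j, hj, hj'⟩ := hm i' i hii
    have hle : m i' i ≤ M :=
      Finset.le_sup (f := fun q : ι × ι ↦ m q.1 q.2) (b := (i', i))
        (Finset.mem_product.2 ⟨hi', hi⟩)
    exact hj' (h2 ⟨j, hj.trans_le hle⟩)
  rw [this]
  exact (hu i hi).2

theorem hSeparable_range_clopenTrace {ι : Type*} {e : ι → ℕ → Bool} (he : HurewiczPowers e) :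
    HSeparable (range (clopenTrace e)) := by
  classical
  intro Y hY
  let P := Σ m : ℕ, (Fin m → Bool) → Bool
  obtain ⟨enum, henum⟩ := exists_surjective_nat P
  obtain ⟨pairs, hpairs⟩ := exists_surjective_nat (ℕ × P)
  let D : P → range (clopenTrace e) := fun p ↦ ⟨clopenTrace e p, mem_range_self p⟩
  have hex : ∀ (k : ℕ) (p : P) (x : Fin k → ι) (n : ℕ), ∃ r,
      D (enum r) ∈ Y n ∧ ∀ i, clopenTrace e (enum r) (x i) = clopenTrace e p (x i) := by
    intro k p x n
    let V : Set (range (clopenTrace e)) :=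
      {f | ∀ i, f.1 (x i) = clopenTrace e p (x i)}
    have hV : IsOpen V := by
      simp only [V, ofPred_forall]
      refine isOpen_iInter_of_finite fun i ↦ ?_
      have hc : Continuous fun f : range (clopenTrace e) ↦ f.1 (x i) :=
        (continuous_apply (x i)).comp continuous_subtype_val
      exact (isOpen_discrete {clopenTrace e p (x i)}).preimage hc
    obtain ⟨f, hfV, hfY⟩ := (hY n).inter_open_nonempty V hV ⟨D p, fun i ↦ rfl⟩
    obtain ⟨q, hq⟩ := f.2
    obtain ⟨r, rfl⟩ := henum q
    have hf : f = D (enum r) := Subtype.ext hq.symm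
    subst hf
    exact ⟨r, hfY, hfV⟩
  let Φ : ∀ (k : ℕ) (_ : P), (Fin k → ι) → ℕ → ℕ := fun k p x n ↦ Nat.find (hex k p x n)
  let Ψ : ∀ (k : ℕ) (_ : P), (Fin k → ι) → ℕ → ℕ := fun k p x n ↦
    (Finset.range (n + 1)).sup (Φ k p x)
  have hΨ : ∀ k p, LocallyBoundedAlong e (Ψ k p) := by
    intro k p x n
    -- Tuples agreeing with `x` up to `M` are not distinguished by `p` or by the witnesses chosen
    -- for `x`, so those witnesses still work.
    let M := p.1 + (Finset.range (n + 1)).sup fun j ↦ (enum (Φ k p x j)).1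
    refine ⟨M, fun y hy ↦ Finset.sup_mono_fun fun j hj ↦ ?_⟩
    obtain ⟨h1, h2⟩ := Nat.find_spec (hex k p x j)
    refine Nat.find_min' _ ⟨h1, fun i ↦ ?_⟩
    have hle : (enum (Φ k p x j)).1 ≤ M :=
      (Finset.le_sup (f := fun j ↦ (enum (Φ k p x j)).1) hj).trans (Nat.le_add_left _ _)
    rw [clopenTrace_congr e hle (hy i), clopenTrace_congr e (p := p) (Nat.le_add_right _ _) (hy i)]
    exact h2 i
  have hmono : ∀ k p x, Monotone (Ψ k p x) := fun k p x n n' h ↦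
    Finset.sup_mono (Finset.range_mono (by omega))
  choose h hh using fun k p ↦ he k (Ψ k p) (hΨ k p) (hmono k p)
  -- Diagonal maximum: it eventually dominates the bound for every pair `(k, p)`.
  let H : ℕ → ℕ := fun n ↦ (Finset.range (n + 1)).sup fun j ↦ h (pairs j).1 (pairs j).2 n
  refine ⟨fun n ↦ ((Finset.range (H n + 1)).image fun r ↦ D (enum r)).filter (· ∈ Y n),
    fun n f hf ↦ ?_, ?_⟩
  · simp only [Finset.coe_filter] at hf
    exact hf.2
  · rintro U hU ⟨⟨_, p, rfl⟩, hfU⟩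
    obtain ⟨W, hW, rfl⟩ := isOpen_induced_iff.1 hU
    obtain ⟨S, u, hu, hSW⟩ := isOpen_pi_iff.1 hW _ hfU
    let x : Fin S.card → ι := fun i ↦ (S.equivFin.symm i).1
    obtain ⟨j, hj⟩ := hpairs (S.card, p)
    have hev : ∀ᶠ n in atTop, (Subtype.val ⁻¹' W ∩
        ((((Finset.range (H n + 1)).image fun r ↦ D (enum r)).filter (· ∈ Y n) :
          Finset (range (clopenTrace e))) : Set (range (clopenTrace e)))) ≠ ∅ := by
      filter_upwards [hh S.card p x, eventually_ge_atTop j] with n hn hjn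
      obtain ⟨h1, h2⟩ := Nat.find_spec (hex S.card p x n)
      have hle1 : Φ S.card p x n ≤ Ψ S.card p x n :=
        Finset.le_sup (f := Φ S.card p x) (Finset.self_mem_range_succ n)
      have hle2 : h S.card p n ≤ H n := by
        have := Finset.le_sup (f := fun j ↦ h (pairs j).1 (pairs j).2 n)
          (Finset.mem_range.2 (Nat.lt_succ_of_le hjn))
        simpa only [hj] using this
      refine nonempty_iff_ne_empty.1 ⟨D (enum (Φ S.card p x n)), hSW fun i hi ↦ ?_, ?_⟩
      · have := h2 (S.equivFin ⟨i, hi⟩)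
        simp only [x, Equiv.symm_apply_apply] at this
        change clopenTrace e (enum (Φ S.card p x n)) i ∈ u i
        rw [show clopenTrace e (enum (Φ S.card p x n)) i = clopenTrace e p i from this]
        exact (hu i hi).2
      · rw [Finset.mem_coe, Finset.mem_filter]
        exact ⟨Finset.mem_image_of_mem (fun r ↦ D (enum r)) (Finset.mem_range.2 (by omega)), h1⟩
    rw [← Nat.cofinite_eq_atTop] at hev
    simpa [Filter.eventually_cofinite] using hev

end ClopenTraces

/-! ### Passage to ideals and conclusion. -/

theorem IsProperAdmissible.mem_of_finite {I : Order.Ideal (Set ℕ)} (hI : IsProperAdmissible I)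
    {s : Set ℕ} (hs : s.Finite) : s ∈ I := by
  induction s, hs using Set.Finite.induction_on with
  | empty => exact I.bot_mem
  | insert _ _ ih =>
    rw [insert_eq]
    exact I.sup_mem (hI.singleton_mem _) ih

theorem HSeparable.idealHSeparable {X : Type*} [TopologicalSpace X] (hX : HSeparable X)
    {I : Order.Ideal (Set ℕ)} (hI : IsProperAdmissible I) : IdealHSeparable I X := by
  intro Y hY
  obtain ⟨F, hF, hU⟩ := hX Y hY
  exact ⟨F, hF, fun U hUo hne ↦ hI.mem_of_finite (hU U hUo hne)⟩

theorem countable_Iio_omega_one_toType (a : (ω₁ : Ordinal.{0}).ToType) : Countable (Iio a) := by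
  rw [← mk_le_aleph0_iff, ← lt_aleph_one_iff]
  simpa using mk_Iio_lt a (by simp)

theorem mainTheorem11 :
    (∃ Y : Set CantorCubeOmegaOne, Dense Y ∧ HSeparable Y) ∧
    ∀ I : Order.Ideal (Set ℕ), IsProperAdmissible I →
      ∃ Y : Set CantorCubeOmegaOne, Y.Countable ∧ Dense Y ∧ IdealHSeparable I Y := by
  obtain ⟨e, he, hH⟩ := exists_injective_hurewiczPowers countable_Iio_omega_one_toType (by simp)
  have hdense := dense_range_clopenTrace he
  have hsep := hSeparable_range_clopenTrace hH
  exact ⟨⟨_, hdense, hsep⟩, fun I hI ↦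
    ⟨_, countable_range _, hdense, hsep.idealHSeparable hI⟩⟩
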